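/- Let $U\subset\mathbb R^{m}$ be a domain (nonempty, connected and open), and let $F$ be a $C^1$ vector field on $U$. For a real-valued $C^2$ function $u$ on $U$ put $$N_F(u):=\frac{\nabla u+F}{|\nabla u+F|},\qquad H_F(u):=\operatorname{div}N_F(u)$$ at points where $\nabla u+F\neq 0$; $U$ is called a nonsingular domain for $u$ if $\nabla u+F\ne 0$ at every point of $U$. For $m=2n$ let $F=(-x^2,x^1,\dots,-x^{2n},x^{2n-1})$; then $H_F(u)$ is the horizontal ($p$-) mean curvature (up to sign) of the graph of $u$ in the Heisenberg group $H_n$. **Corollary I.** Let $m=2n\ge 4$ and $F=(-x^2,x^1,\dots,-x^{2n},x^{2n-1})$. Let $u,v$ be $C^2$ real-valued functions on a domain $U\subset\mathbb R^{2n}$ that is nonsingular for both $u$ and $v$. Suppose $H_F(u)\le H_F(v)$ and $u\ge v$ in $U$, and $u=v$ at some point $p_0\in U$. Then $u\equiv v$ in $U$. This fails for $m=2$, $F=(-x^2,x^1)$: let $U=\{x^1>0,\ x^1+x^2>0\}\subset\mathbb R^2$, $u=x^1x^2+(x^2)^2$ and $v=x^1x^2$. Then $u,v$ are $C^2$ on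 $U$, $U$ is a nonsingular domain for both $u$ and $v$, $H_F(u)=H_F(v)=0$ and $u\ge v$ in $U$, and $u=v$ at some point of $U$; in fact, at a point of $U$, $u=v$ holds if and only if $x^2=0$. In particular $u\not\equiv v$ in $U$. -/

import Mathlib

noncomputable section

/-- Divergence `∑ i, ∂ V_i / ∂ x^i` of a vector field on `ℝ^m`. -/
def divergence {m : ℕ} (V : EuclideanSpace ℝ (Fin m) → EuclideanSpace ℝ (Fin m))
    (x : EuclideanSpace ℝ (Fin m)) : ℝ :=
  ∑ i : Fin m, (fderiv ℝ V x (EuclideanSpace.single i 1)) i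

/-- The Legendrian (or horizontal) normal `N_F(u) = (∇u + F) / |∇u + F|`;
meaningful where `∇u + F ≠ 0`. -/
def legendrianNormal {m : ℕ} (F : EuclideanSpace ℝ (Fin m) → EuclideanSpace ℝ (Fin m))
    (u : EuclideanSpace ℝ (Fin m) → ℝ) (x : EuclideanSpace ℝ (Fin m)) :
    EuclideanSpace ℝ (Fin m) :=
  ‖gradient u x + F x‖⁻¹ • (gradient u x + F x)

/-- The generalized horizontal (or `p`-) mean curvature `H_F(u) = div N_F(u)`. -/
def horizontalMeanCurvature {m : ℕ}
    (F : EuclideanSpace ℝ (Fin m) → EuclideanSpace ℝ (Fin m))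
    (u : EuclideanSpace ℝ (Fin m) → ℝ) (x : EuclideanSpace ℝ (Fin m)) : ℝ :=
  divergence (legendrianNormal F u) x

/-- `U` is a nonsingular domain for `u`: a connected open set on which `∇u + F` never vanishes. -/
def IsNonsingularDomain {m : ℕ} (F : EuclideanSpace ℝ (Fin m) → EuclideanSpace ℝ (Fin m))
    (u : EuclideanSpace ℝ (Fin m) → ℝ) (U : Set (EuclideanSpace ℝ (Fin m))) : Prop :=
  IsOpen U ∧ IsConnected U ∧ ∀ x ∈ U, gradient u x + F x ≠ 0

/-- The vector field `F = (-x², x¹, …, -x²ⁿ, x²ⁿ⁻¹)` on `ℝ^{2n}`. The coordinate `xʲ` (`j ≥ 1`)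
has index `j - 1` in `Fin (2 * n)`. -/
def heisenbergField (n : ℕ) (x : EuclideanSpace ℝ (Fin (2 * n))) :
    EuclideanSpace ℝ (Fin (2 * n)) :=
  WithLp.toLp 2 fun i : Fin (2 * n) =>
    if h : i.val % 2 = 0 then -x ⟨i.val + 1, by have := i.isLt; omega⟩
    else x ⟨i.val - 1, by have := i.isLt; omega⟩

end

/-! Put `a = ∇u + F` and let `Z = {u = v}`.

By Hopf's boundary point lemma, every vector pointing from a point of `Z` to the centre of a ball
touching `Z` there is a multiple of `a`: the function `u - v ≥ 0` satisfies a linear second-order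
differential inequality whose principal symbol, the derivative of `q ↦ q / |q|` at `a`, is positive
semidefinite with kernel spanned by `a`.

If such a vector at a point `p` of `Z` is nonzero, the points of `Z` nearest to points close to its
tip trace curves in `Z` tangent to all directions in the hyperplane `a^⊥`. Comparing points of `Z`
along small closed polygons, the touching-ball inequalities sum to the symmetry of `Da` on `a^⊥`.
The Hessian of `u` is symmetric, so `DF` would be symmetric on `a^⊥`. For the Heisenberg field
`DF = J` is skew with `J ^ 2 = -1`; in dimension at least four there is `ξ ≠ 0` orthogonal to `a`
and `J a`, and the vectors `ξ` and `J ξ` in `a^⊥` violate the symmetry. So no such vector exists,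
`Z` is open, and connectedness concludes. -/

open Filter Topology Metric Set
open scoped RealInnerProductSpace

local notation "𝐧" => NormedSpace.normalize

section Hessian

variable {E : Type*} [NormedAddCommGroup E] [InnerProductSpace ℝ E] [CompleteSpace E]
  {f g : E → ℝ} {x : E}

/-- The Hessian of `f` at `x` as an endomorphism, the derivative of the gradient. -/
noncomputable def hessian (f : E → ℝ) (x : E) : E →L[ℝ] E := fderiv ℝ (gradient f) x

lemma contDiffAt_gradient (hf : ContDiffAt ℝ 2 f x) : ContDiffAt ℝ 1 (gradient f) x :=
  (InnerProductSpace.toDual ℝ E).symm.contDiff.contDiffAt.comp x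
    (hf.fderiv_right (m := 1) (by norm_num))

lemma hasFDerivAt_gradient (hf : ContDiffAt ℝ 2 f x) :
    HasFDerivAt (gradient f) (hessian f x) x :=
  ((contDiffAt_gradient hf).differentiableAt one_ne_zero).hasFDerivAt

lemma gradient_sub (hf : DifferentiableAt ℝ f x) (hg : DifferentiableAt ℝ g x) :
    gradient (fun y => f y - g y) x = gradient f x - gradient g x := by
  simp only [gradient, fderiv_fun_sub hf hg, map_sub]

lemma hessian_sub (hf : ContDiffAt ℝ 2 f x) (hg : ContDiffAt ℝ 2 g x) :
    hessian (fun y => f y - g y) x = hessian f x - hessian g x := by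
  have hgrad : gradient (fun y => f y - g y) =ᶠ[𝓝 x] fun y => gradient f y - gradient g y := by
    filter_upwards [hf.eventually (by simp), hg.eventually (by simp)] with y hfy hgy
    exact gradient_sub (hfy.differentiableAt two_ne_zero) (hgy.differentiableAt two_ne_zero)
  rw [hessian, hgrad.fderiv_eq]
  exact ((hasFDerivAt_gradient hf).sub (hasFDerivAt_gradient hg)).fderiv

lemma gradient_const_mul (hf : DifferentiableAt ℝ f x) (c : ℝ) :
    gradient (fun y => c * f y) x = c • gradient f x := by
  simp only [gradient, fderiv_const_mul hf, map_smulₛₗ, conj_trivial]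

lemma hessian_const_mul (hf : ContDiffAt ℝ 2 f x) (c : ℝ) :
    hessian (fun y => c * f y) x = c • hessian f x := by
  have hgrad : gradient (fun y => c * f y) =ᶠ[𝓝 x] fun y => c • gradient f y := by
    filter_upwards [hf.eventually (by simp)] with y hfy
    exact gradient_const_mul (hfy.differentiableAt two_ne_zero) c
  rw [hessian, hgrad.fderiv_eq]
  exact ((hasFDerivAt_gradient hf).const_smul c).fderiv

lemma continuousAt_hessian (hf : ContDiffAt ℝ 2 f x) : ContinuousAt (hessian f) x :=
  ((contDiffAt_gradient hf).fderiv_right (m := 0) (by norm_num)).continuousAt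

lemma inner_hessian_eq_fderiv_fderiv (hf : ContDiffAt ℝ 2 f x) (ξ ζ : E) :
    ⟪hessian f x ξ, ζ⟫ = fderiv ℝ (fderiv ℝ f) x ξ ζ := by
  have hderiv : DifferentiableAt ℝ (fderiv ℝ f) x :=
    (hf.fderiv_right (m := 1) (by norm_num)).differentiableAt one_ne_zero
  have hinner := (hasFDerivAt_gradient hf).inner ℝ (hasFDerivAt_const ζ x)
  simp only [inner_gradient_left] at hinner
  simpa using DFunLike.congr_fun
    (hinner.unique (hderiv.hasFDerivAt.clm_apply (hasFDerivAt_const ζ x))) ξ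

lemma inner_hessian_comm (hf : ContDiffAt ℝ 2 f x) (ξ ζ : E) :
    ⟪hessian f x ξ, ζ⟫ = ⟪hessian f x ζ, ξ⟫ := by
  rw [inner_hessian_eq_fderiv_fderiv hf, inner_hessian_eq_fderiv_fderiv hf]
  exact (hf.isSymmSndFDerivAt (by simp)).eq ξ ζ

lemma gradient_eq_zero_of_isLocalMin (hx : IsLocalMin f x) : gradient f x = 0 := by
  rw [gradient, hx.fderiv_eq_zero, map_zero]

lemma hasDerivAt_comp_line (hf : DifferentiableAt ℝ f x) (y ξ : E) {t : ℝ} (ht : y + t • ξ = x) :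
    HasDerivAt (fun s => f (y + s • ξ)) ⟪gradient f x, ξ⟫ t := by
  have hline : HasDerivAt (fun s : ℝ => y + s • ξ) ξ t := by
    simpa using ((hasDerivAt_id t).smul_const ξ).const_add y
  subst ht
  simpa [gradient, Function.comp_def] using hf.hasFDerivAt.comp_hasDerivAt t hline

lemma inner_hessian_nonneg_of_isLocalMin (hf : ContDiffAt ℝ 2 f x) (hx : IsLocalMin f x) (ξ : E) :
    0 ≤ ⟪hessian f x ξ, ξ⟫ := by
  set φ : ℝ → ℝ := fun t => f (x + t • ξ)
  have hline : Tendsto (fun t : ℝ => x + t • ξ) (𝓝 0) (𝓝 x) :=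
    Continuous.tendsto' (by fun_prop) _ _ (by simp)
  have hφ : deriv φ =ᶠ[𝓝 0] fun t => ⟪gradient f (x + t • ξ), ξ⟫ := by
    filter_upwards [hline.eventually (hf.eventually (by simp))] with t ht
    exact (hasDerivAt_comp_line (ht.differentiableAt two_ne_zero) x ξ rfl).deriv
  have hφ' : deriv (deriv φ) 0 = ⟪hessian f x ξ, ξ⟫ := by
    have hderiv : HasDerivAt (fun t : ℝ => x + t • ξ) ξ 0 := by
      simpa using ((hasDerivAt_id (0 : ℝ)).smul_const ξ).const_add x
    have hgrad : HasDerivAt (fun t : ℝ => gradient f (x + t • ξ)) (hessian f x ξ) 0 :=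
      HasFDerivAt.comp_hasDerivAt_of_eq 0 (hasFDerivAt_gradient hf) hderiv (by simp)
    simpa using hφ.deriv_eq.trans (hgrad.inner ℝ (hasDerivAt_const 0 ξ)).deriv
  have hmin : IsLocalMin φ 0 := by
    simpa [IsLocalMin, IsMinFilter, φ] using hline.eventually hx
  by_contra! hneg
  have hmax : IsLocalMax φ 0 := by
    refine isLocalMax_of_deriv_deriv_neg (hφ'.trans_lt hneg) hmin.deriv_eq_zero ?_
    have := hf.continuousAt
    exact ContinuousAt.comp_of_eq this (by fun_prop) (by simp)
  have hconst : φ =ᶠ[𝓝 0] fun _ => φ 0 := by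
    filter_upwards [hmin, hmax] with t h₁ h₂ using le_antisymm h₂ h₁
  have : deriv (deriv φ) 0 = 0 := by
    simpa using hconst.deriv.deriv_eq
  exact hneg.ne (hφ' ▸ this)

end Hessian

section Trace

variable {E : Type*} [NormedAddCommGroup E] [InnerProductSpace ℝ E] [FiniteDimensional ℝ E]

/-- The trace as a continuous linear functional on the continuous endomorphisms. -/
noncomputable def traceCLM (E : Type*) [NormedAddCommGroup E] [InnerProductSpace ℝ E]
    [FiniteDimensional ℝ E] : (E →L[ℝ] E) →L[ℝ] ℝ :=
  LinearMap.toContinuousLinearMap (LinearMap.trace ℝ E ∘ₗ ContinuousLinearMap.coeLM ℝ)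

lemma traceCLM_apply (L : E →L[ℝ] E) : traceCLM E L = LinearMap.trace ℝ E L := rfl

lemma traceCLM_comp_rankOne_self (L : E →L[ℝ] E) (z : E) :
    traceCLM E (L ∘L InnerProductSpace.rankOne ℝ z z) = ⟪z, L z⟫ := by
  rw [InnerProductSpace.comp_rankOne, traceCLM_apply, InnerProductSpace.trace_rankOne]

lemma traceCLM_comp_nonneg {P S : E →L[ℝ] E} (hP : P.IsPositive) (hS : ∀ ξ, 0 ≤ ⟪S ξ, ξ⟫) :
    0 ≤ traceCLM E (P ∘L S) := by
  have hP' : (P : E →ₗ[ℝ] E).IsPositive := hP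
  let e := hP'.isSymmetric.eigenvectorBasis rfl
  rw [traceCLM_apply, LinearMap.trace_eq_sum_inner _ e]
  refine Finset.sum_nonneg fun i _ => ?_
  have heig : P (e i) = hP'.isSymmetric.eigenvalues rfl i • e i :=
    hP'.isSymmetric.apply_eigenvectorBasis rfl i
  calc 0 ≤ hP'.isSymmetric.eigenvalues rfl i * ⟪S (e i), e i⟫ :=
        mul_nonneg (hP'.nonneg_eigenvalues rfl i) (hS _)
    _ = ⟪e i, P (S (e i))⟫ := by
        rw [real_inner_comm, ← real_inner_smul_left, ← heig]
        exact hP'.isSymmetric _ _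

end Trace

section Normalize

variable {E : Type*} [NormedAddCommGroup E] [InnerProductSpace ℝ E] {p : E}

lemma contDiffAt_normalize {n : WithTop ℕ∞} (hp : p ≠ 0) :
    ContDiffAt ℝ n 𝐧 p :=
  ((contDiffAt_norm ℝ hp).inv (norm_ne_zero_iff.2 hp)).smul contDiffAt_id

lemma fderiv_norm_apply (hp : p ≠ 0) (ξ : E) :
    fderiv ℝ (fun q : E => ‖q‖) p ξ = ⟪𝐧 p, ξ⟫ := by
  have hn : DifferentiableAt ℝ (fun q : E => ‖q‖) p :=
    (contDiffAt_norm ℝ hp (n := 1)).differentiableAt one_ne_zero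
  have hsq := (hn.hasFDerivAt.pow 2).unique (hasStrictFDerivAt_norm_sq p).hasFDerivAt
  have hsq' : 2 * ‖p‖ * fderiv ℝ (fun q : E => ‖q‖) p ξ = 2 * ⟪p, ξ⟫ := by
    simpa using DFunLike.congr_fun hsq ξ
  have := norm_ne_zero_iff.2 hp
  rw [NormedSpace.normalize, real_inner_smul_left]
  field_simp
  linarith

lemma fderiv_normalize (hp : p ≠ 0) (ξ : E) :
    fderiv ℝ 𝐧 p ξ = ‖p‖⁻¹ • (ξ - ⟪𝐧 p, ξ⟫ • 𝐧 p) := by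
  have hp' := norm_ne_zero_iff.2 hp
  have hn : DifferentiableAt ℝ (fun q : E => ‖q‖) p :=
    (contDiffAt_norm ℝ hp (n := 1)).differentiableAt one_ne_zero
  have h : HasFDerivAt 𝐧 _ p :=
    ((hasDerivAt_inv hp').comp_hasFDerivAt p hn.hasFDerivAt).smul (hasFDerivAt_id p)
  rw [h.fderiv]
  simp only [Function.comp_apply, neg_smul, add_apply, smul_apply, ContinuousLinearMap.id_apply,
    ContinuousLinearMap.smulRight_apply, neg_apply, fderiv_norm_apply hp, smul_eq_mul]
  simp only [NormedSpace.normalize]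
  module

lemma inner_fderiv_normalize (hp : p ≠ 0) (ξ ζ : E) :
    ⟪fderiv ℝ 𝐧 p ξ, ζ⟫
      = ‖p‖⁻¹ * (⟪ξ, ζ⟫ - ⟪𝐧 p, ξ⟫ * ⟪𝐧 p, ζ⟫) := by
  rw [fderiv_normalize hp, real_inner_smul_left, inner_sub_left, real_inner_smul_left]

lemma inner_fderiv_normalize_self (hp : p ≠ 0) (ξ : E) :
    ⟪fderiv ℝ 𝐧 p ξ, ξ⟫ = ‖p‖⁻¹ * ‖ξ - ⟪𝐧 p, ξ⟫ • 𝐧 p‖ ^ 2 := by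
  have hunit : ‖𝐧 p‖ = 1 := NormedSpace.norm_normalize_eq_one_iff.2 hp
  rw [inner_fderiv_normalize hp, norm_sub_sq_real, norm_smul, hunit, real_inner_smul_right,
    real_inner_comm (𝐧 p) ξ, Real.norm_eq_abs, mul_one, sq_abs, real_inner_self_eq_norm_sq]
  ring

lemma isPositive_fderiv_normalize (hp : p ≠ 0) :
    (fderiv ℝ 𝐧 p).IsPositive := by
  refine (ContinuousLinearMap.isPositive_iff _).2 ⟨fun ξ ζ => ?_, fun ξ => ?_⟩
  · change ⟪fderiv ℝ 𝐧 p ξ, ζ⟫ = ⟪ξ, fderiv ℝ 𝐧 p ζ⟫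
    rw [real_inner_comm _ ξ, inner_fderiv_normalize hp, inner_fderiv_normalize hp,
      real_inner_comm ξ ζ, mul_comm ⟪𝐧 p, ξ⟫]
  · change 0 ≤ ⟪fderiv ℝ 𝐧 p ξ, ξ⟫
    rw [inner_fderiv_normalize_self hp]
    positivity

lemma exists_eq_smul_of_inner_fderiv_normalize_nonpos (hp : p ≠ 0) {ξ : E}
    (hξ : ⟪fderiv ℝ 𝐧 p ξ, ξ⟫ ≤ 0) : ∃ c : ℝ, ξ = c • p := by
  rw [inner_fderiv_normalize_self hp] at hξ
  have hsq := nonpos_of_mul_nonpos_right hξ (inv_pos.2 (norm_pos_iff.2 hp))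
  have hnorm : ‖ξ - ⟪𝐧 p, ξ⟫ • 𝐧 p‖ = 0 := pow_eq_zero_iff two_ne_zero |>.1
    (le_antisymm hsq (sq_nonneg _))
  exact ⟨⟪𝐧 p, ξ⟫ * ‖p‖⁻¹, by
    rw [mul_smul]; exact sub_eq_zero.1 (norm_eq_zero.1 hnorm)⟩

end Normalize

section Hopf

lemma exists_pos_forall_mul_lt {X : Type*} [TopologicalSpace X] [T2Space X] {s : Set X}
    {w h : X → ℝ} (hs : IsCompact s) (hwc : ContinuousOn w s) (hhc : ContinuousOn h s)
    (hw : ∀ x ∈ s, 0 ≤ w x) (hwh : ∀ x ∈ s, 0 ≤ h x → 0 < w x) :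
    ∃ ε > 0, ∀ x ∈ s, ε * h x < w x := by
  set K := s ∩ h ⁻¹' Ici 0
  have hK : IsCompact K := hs.of_isClosed_subset
    (hhc.preimage_isClosed_of_isClosed hs.isClosed isClosed_Ici) inter_subset_left
  obtain ⟨m, hm, hmw⟩ : ∃ m > 0, ∀ x ∈ K, m ≤ w x := by
    rcases K.eq_empty_or_nonempty with hempty | hne
    · exact ⟨1, one_pos, by simp [hempty]⟩
    · obtain ⟨x₀, hx₀, hmin⟩ := hK.exists_isMinOn hne (hwc.mono inter_subset_left)
      exact ⟨w x₀, hwh x₀ hx₀.1 hx₀.2, fun x hx => hmin hx⟩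
  obtain ⟨M, hM⟩ := hK.exists_bound_of_continuousOn (hhc.mono inter_subset_left)
  set ε := m / (|M| + 1)
  have hε : 0 < ε := by positivity
  refine ⟨ε, hε, fun x hx => ?_⟩
  rcases lt_or_ge (h x) 0 with hneg | hnonneg
  · exact (mul_neg_of_pos_of_neg hε hneg).trans_le (hw x hx)
  · have hhM : h x < |M| + 1 := by
      linarith [(le_abs_self _).trans (hM x ⟨hx, hnonneg⟩), le_abs_self M]
    calc ε * h x < ε * (|M| + 1) := by gcongr
      _ = m := div_mul_cancel₀ m (by positivity)
      _ ≤ w x := hmw x ⟨hx, hnonneg⟩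

lemma exists_isLocalMin_sub_mul {E : Type*} [NormedAddCommGroup E] [ProperSpace E] {w h : E → ℝ}
    {y : E} {ρ : ℝ} (hρ : 0 ≤ ρ) (hwc : ContinuousOn w (closedBall y ρ))
    (hhc : ContinuousOn h (closedBall y ρ)) (hwy : w y = 0) (hhy : h y = 0)
    (hw : ∀ x ∈ sphere y ρ, 0 ≤ w x) (hwh : ∀ x ∈ sphere y ρ, 0 ≤ h x → 0 < w x) :
    ∃ ε > 0, ∃ x ∈ ball y ρ, IsLocalMin (fun z => w z - ε * h z) x := by
  obtain ⟨ε, hε, hpos⟩ := exists_pos_forall_mul_lt (isCompact_sphere y ρ)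
    (hwc.mono sphere_subset_closedBall) (hhc.mono sphere_subset_closedBall) hw hwh
  obtain ⟨x, hx, hmin⟩ := (isCompact_closedBall y ρ).exists_isMinOn ⟨y, mem_closedBall_self hρ⟩
    (hwc.sub (continuousOn_const.mul hhc) : ContinuousOn (fun z => w z - ε * h z) _)
  have hle : w x - ε * h x ≤ 0 := by
    simpa [hwy, hhy] using isMinOn_iff.1 hmin y (mem_closedBall_self hρ)
  have hxball : x ∈ ball y ρ := by
    rcases (mem_closedBall.1 hx).eq_or_lt with heq | hlt
    · exact absurd (sub_pos.2 (hpos x heq)) hle.not_gt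
    · exact hlt
  exact ⟨ε, hε, x, hxball, hmin.isLocalMin (closedBall_mem_nhds_of_mem hxball)⟩

variable {E : Type*} [NormedAddCommGroup E] [InnerProductSpace ℝ E] [FiniteDimensional ℝ E]
  {g : E → E →L[ℝ] E} {w : E → ℝ} {y : E} {C : ℝ}

lemma traceCLM_comp_hessian_le_of_isLocalMin {w φ : E → ℝ} {x : E} {P : E →L[ℝ] E}
    (hP : P.IsPositive) (hw : ContDiffAt ℝ 2 w x) (hφ : ContDiffAt ℝ 2 φ x)
    (hmin : IsLocalMin (fun z => w z - φ z) x) :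
    traceCLM E (P ∘L hessian φ x) ≤ traceCLM E (P ∘L hessian w x) := by
  have := traceCLM_comp_nonneg hP (inner_hessian_nonneg_of_isLocalMin (hw.sub hφ) hmin)
  rw [hessian_sub hw hφ, ContinuousLinearMap.comp_sub, map_sub] at this
  exact sub_nonneg.1 this

lemma traceCLM_comp_hessian_le_of_touching {h : E → ℝ} (hg : ContinuousAt g y)
    (hpos : ∀ᶠ x in 𝓝 y, (g x).IsPositive) (hw : ContDiffAt ℝ 2 w y)
    (hineq : ∀ᶠ x in 𝓝 y, traceCLM E (g x ∘L hessian w x) ≤ C * ‖gradient w x‖)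
    (hw0 : ∀ᶠ x in 𝓝 y, 0 ≤ w x) (hwy : w y = 0) (hh : ContDiffAt ℝ 2 h y) (hhy : h y = 0)
    (hwh : ∀ᶠ x in 𝓝 y, x ≠ y → 0 ≤ h x → 0 < w x) :
    traceCLM E (g y ∘L hessian h y) ≤ C * ‖gradient h y‖ := by
  by_contra! hstrict
  have hstrict' : ∀ᶠ x in 𝓝 y, C * ‖gradient h x‖ < traceCLM E (g x ∘L hessian h x) :=
    ContinuousAt.eventually_lt
      (continuousAt_const.mul (contDiffAt_gradient hh).continuousAt.norm)
      ((traceCLM E).continuous.continuousAt.comp (hg.clm_comp (continuousAt_hessian hh))) hstrict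
  obtain ⟨r, hr, hall⟩ := Metric.eventually_nhds_iff_ball.1 (hpos.and (hineq.and (hw0.and
    (hwh.and (hstrict'.and ((hw.eventually (by simp)).and (hh.eventually (by simp))))))))
  have hsub : closedBall y (r / 2) ⊆ ball y r := closedBall_subset_ball (by linarith)
  obtain ⟨ε, hε, x, hx, hmin⟩ := exists_isLocalMin_sub_mul (ρ := r / 2) (by positivity)
    (fun x hx => (hall x (hsub hx)).2.2.2.2.2.1.continuousAt.continuousWithinAt)
    (fun x hx => (hall x (hsub hx)).2.2.2.2.2.2.continuousAt.continuousWithinAt) hwy hhy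
    (fun x hx => (hall x (hsub (sphere_subset_closedBall hx))).2.2.1)
    (fun x hx => (hall x (hsub (sphere_subset_closedBall hx))).2.2.2.1
      (ne_of_mem_sphere hx (by positivity)))
  obtain ⟨hPx, hineqx, -, -, hstrictx, hwx, hhx⟩ := hall x (hsub (ball_subset_closedBall hx))
  have hεh : ContDiffAt ℝ 2 (fun z => ε * h z) x := contDiffAt_const.mul hhx
  have hgrad : gradient w x = ε • gradient h x := by
    rw [← sub_eq_zero, ← gradient_const_mul (hhx.differentiableAt two_ne_zero),
      ← gradient_sub (hwx.differentiableAt two_ne_zero) (hεh.differentiableAt two_ne_zero)]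
    exact gradient_eq_zero_of_isLocalMin hmin
  have htrace := traceCLM_comp_hessian_le_of_isLocalMin hPx hwx hεh hmin
  rw [hessian_const_mul hhx, ContinuousLinearMap.comp_smul, map_smul, smul_eq_mul] at htrace
  rw [hgrad, norm_smul, Real.norm_of_nonneg hε.le] at hineqx
  have := mul_lt_mul_of_pos_left hstrictx hε
  linarith

lemma hasGradientAt_exp_neg_mul_sq (α b : ℝ) (c x : E) :
    HasGradientAt (fun x => Real.exp (-α * ‖x - c‖ ^ 2) - b)
      ((-2 * α * Real.exp (-α * ‖x - c‖ ^ 2)) • (x - c)) x := by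
  have hsq : HasFDerivAt (fun x : E => ‖x - c‖ ^ 2) (2 • (innerSL ℝ (x - c))) x := by
    simpa using ((hasFDerivAt_id x).sub_const c).norm_sq
  rw [hasGradientAt_iff_hasFDerivAt]
  refine (((hsq.const_mul (-α)).exp).sub_const b).congr_fderiv ?_
  ext ξ
  simp only [neg_mul, map_sub, neg_smul, smul_neg, neg_apply, smul_apply, sub_apply,
    coe_innerSL_apply, nsmul_eq_mul, Nat.cast_ofNat, smul_eq_mul, map_neg, map_smul,
    InnerProductSpace.toDual_apply_apply, neg_inj]
  ring

lemma hessian_exp_neg_mul_sq (α b : ℝ) (c x : E) :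
    hessian (fun x => Real.exp (-α * ‖x - c‖ ^ 2) - b) x
      = (2 * α * Real.exp (-α * ‖x - c‖ ^ 2)) •
        ((2 * α) • InnerProductSpace.rankOne ℝ (x - c) (x - c) - ContinuousLinearMap.id ℝ E) := by
  have hgrad : gradient (fun x => Real.exp (-α * ‖x - c‖ ^ 2) - b) = fun x =>
      (-2 * α * Real.exp (-α * ‖x - c‖ ^ 2)) • (x - c) :=
    funext fun x => (hasGradientAt_exp_neg_mul_sq α b c x).gradient
  have hsq : HasFDerivAt (fun x : E => ‖x - c‖ ^ 2) (2 • (innerSL ℝ (x - c))) x := by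
    simpa using ((hasFDerivAt_id x).sub_const c).norm_sq
  rw [hessian, hgrad]
  refine HasFDerivAt.fderiv <| ((((hsq.const_mul (-α)).exp).const_mul (-2 * α)).smul
    ((hasFDerivAt_id x).sub_const c)).congr_fderiv <| ContinuousLinearMap.ext fun ξ => ?_
  simp only [add_apply, sub_apply, smul_apply, ContinuousLinearMap.smulRight_apply,
    InnerProductSpace.rankOne_apply, innerSL_apply_apply, ContinuousLinearMap.id_apply, id,
    smul_eq_mul]
  module

lemma inner_nonpos_of_touching_closedBall {c : E} (hg : ContinuousAt g y)
    (hpos : ∀ᶠ x in 𝓝 y, (g x).IsPositive) (hw : ContDiffAt ℝ 2 w y)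
    (hineq : ∀ᶠ x in 𝓝 y, traceCLM E (g x ∘L hessian w x) ≤ C * ‖gradient w x‖)
    (hw0 : ∀ᶠ x in 𝓝 y, 0 ≤ w x) (hwy : w y = 0)
    (hball : ∀ᶠ x in 𝓝 y, x ≠ y → x ∈ closedBall c ‖y - c‖ → 0 < w x) :
    ⟪y - c, g y (y - c)⟫ ≤ 0 := by
  have hα : ∀ α > 0, 2 * α * ⟪y - c, g y (y - c)⟫ ≤ traceCLM E (g y) + C * ‖y - c‖ := by
    intro α hα
    have htrace := traceCLM_comp_hessian_le_of_touching
      (h := fun x => Real.exp (-α * ‖x - c‖ ^ 2) - Real.exp (-α * ‖y - c‖ ^ 2))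
      hg hpos hw hineq hw0 hwy
      (((contDiffAt_const.mul ((contDiff_id.sub contDiff_const).norm_sq ℝ).contDiffAt).exp).sub
        contDiffAt_const) (sub_self _) (hball.mono fun x hx hne hh => hx hne ?_)
    · have hk : 0 < 2 * α * Real.exp (-α * ‖y - c‖ ^ 2) := by positivity
      have hnorm : ‖-2 * α * Real.exp (-α * ‖y - c‖ ^ 2)‖
          = 2 * α * Real.exp (-α * ‖y - c‖ ^ 2) := by
        rw [← Real.norm_of_nonneg hk.le, ← norm_neg]
        ring_nf
      rw [hessian_exp_neg_mul_sq, (hasGradientAt_exp_neg_mul_sq _ _ _ _).gradient,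
        ContinuousLinearMap.comp_smul, ContinuousLinearMap.comp_sub,
        ContinuousLinearMap.comp_smul, ContinuousLinearMap.comp_id, map_smul, map_sub, map_smul,
        traceCLM_comp_rankOne_self, norm_smul, hnorm, smul_eq_mul, smul_eq_mul,
        mul_left_comm] at htrace
      linarith [le_of_mul_le_mul_left htrace hk]
    · rw [mem_closedBall, dist_eq_norm]
      rw [sub_nonneg, Real.exp_le_exp] at hh
      exact le_of_sq_le_sq (by nlinarith) (norm_nonneg _)
  by_contra! hδ
  have := hα _ (by positivity :
    0 < (|traceCLM E (g y) + C * ‖y - c‖| + 1) / (2 * ⟪y - c, g y (y - c)⟫))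
  field_simp at this
  linarith [le_abs_self (traceCLM E (g y) + C * ‖y - c‖)]

end Hopf

section NearestPoint

variable {E : Type*} [NormedAddCommGroup E] {Z : Set E} {q x z n : E}

/-- `x` is a point of `Z` closest to `q`; equivalently, `q - x` is a proximal normal of `Z` at `x`
with a ball centred at `q` touching `Z` at `x`. -/
def IsNearestPoint (Z : Set E) (q x : E) : Prop :=
  x ∈ Z ∧ ∀ z ∈ Z, ‖q - x‖ ≤ ‖q - z‖

lemma exists_isNearestPoint [ProperSpace E] (hZ : IsClosed Z) (hne : Z.Nonempty) (q : E) :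
    ∃ x, IsNearestPoint Z q x := by
  obtain ⟨x, hx, hdist⟩ := hZ.exists_infDist_eq_dist hne q
  refine ⟨x, hx, fun z hz => ?_⟩
  rw [← dist_eq_norm, ← dist_eq_norm, ← hdist]
  exact infDist_le_dist_of_mem hz

lemma exists_isNearestPoint_mem_of_notMem_nhds [ProperSpace E] {y : E} {s : Set E}
    (hZ : IsClosed Z) (hy : y ∈ Z) (hZy : Z ∉ 𝓝 y) (hs : s ∈ 𝓝 y) :
    ∃ p ∈ s, ∃ q, q ≠ p ∧ IsNearestPoint Z q p := by
  obtain ⟨r, hr, hrs⟩ := Metric.mem_nhds_iff.1 hs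
  obtain ⟨q, hqball, hqZ⟩ : ∃ q ∈ ball y (r / 2), q ∉ Z :=
    not_subset.1 fun hsub => hZy (mem_of_superset (ball_mem_nhds y (by positivity)) hsub)
  obtain ⟨p, hp⟩ := exists_isNearestPoint hZ ⟨y, hy⟩ q
  refine ⟨p, hrs ?_, q, fun h => hqZ (h ▸ hp.1), hp⟩
  rw [mem_ball, dist_eq_norm] at hqball ⊢
  have := norm_sub_le_norm_sub_add_norm_sub p q y
  rw [norm_sub_rev p q] at this
  linarith [hp.2 y hy]

variable [InnerProductSpace ℝ E]

lemma norm_sub_sq_eq_add (q x z : E) :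
    ‖q - z‖ ^ 2 = ‖q - x‖ ^ 2 - 2 * ⟪q - x, z - x⟫ + ‖z - x‖ ^ 2 := by
  rw [← norm_sub_sq_real, sub_sub_sub_cancel_right]

lemma isNearestPoint_iff :
    IsNearestPoint Z q x ↔ x ∈ Z ∧ ∀ z ∈ Z, 2 * ⟪q - x, z - x⟫ ≤ ‖z - x‖ ^ 2 := by
  refine and_congr_right fun _ => forall₂_congr fun z _ => ?_
  rw [← sq_le_sq₀ (norm_nonneg _) (norm_nonneg _), norm_sub_sq_eq_add q x z]
  constructor <;> intro h <;> linarith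

namespace IsNearestPoint

lemma eq_of_mem_closedBall_midpoint (hx : IsNearestPoint Z q x) (hz : z ∈ Z)
    (hzball : z ∈ closedBall (midpoint ℝ x q) ‖x - midpoint ℝ x q‖) : z = x := by
  have hinner := (isNearestPoint_iff.1 hx).2 z hz
  rw [mem_closedBall, dist_eq_norm, norm_sub_rev, norm_sub_rev x,
    ← sq_le_sq₀ (norm_nonneg _) (norm_nonneg _), norm_sub_sq_eq_add _ x z, midpoint_sub_left,
    real_inner_smul_left, invOf_eq_inv] at hzball
  rw [← sub_eq_zero, ← norm_eq_zero, ← sq_eq_zero_iff]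
  exact le_antisymm (by linarith) (sq_nonneg _)

lemma add_smul {s : ℝ} (h : IsNearestPoint Z (x + n) x) (hs₀ : 0 ≤ s) (hs₁ : s ≤ 1) :
    IsNearestPoint Z (x + s • n) x := by
  rw [isNearestPoint_iff] at h ⊢
  refine ⟨h.1, fun z hz => ?_⟩
  have hz' := h.2 z hz
  rw [add_sub_cancel_left] at hz' ⊢
  rw [real_inner_smul_left]
  nlinarith [sq_nonneg ‖z - x‖]

lemma norm_sub_sq_le (hz : IsNearestPoint Z q z) (hx : x ∈ Z) (n : E) :
    ‖z - x‖ ^ 2 ≤ 2 * ⟪n, z - x⟫ + 2 * (‖q - (x + n)‖ * ‖z - x‖) := by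
  have hle := hz.2 x hx
  rw [← sq_le_sq₀ (norm_nonneg _) (norm_nonneg _), norm_sub_sq_eq_add q x z] at hle
  have hsplit : ⟪q - x, z - x⟫ = ⟪n, z - x⟫ + ⟪q - (x + n), z - x⟫ := by
    rw [← inner_add_left]
    congr 1
    abel
  linarith [real_inner_le_norm (q - (x + n)) (z - x)]

lemma four_mul_inner_le (hx : IsNearestPoint Z (x + (2 : ℝ) • n) x) (hz : z ∈ Z) :
    4 * ⟪n, z - x⟫ ≤ ‖z - x‖ ^ 2 := by
  have h := (isNearestPoint_iff.1 hx).2 z hz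
  rw [add_sub_cancel_left, real_inner_smul_left] at h
  linarith

lemma norm_sub_le (hx : IsNearestPoint Z (x + (2 : ℝ) • n) x) (hz : IsNearestPoint Z q z) :
    ‖z - x‖ ≤ 4 * ‖q - (x + n)‖ := by
  by_contra! hlt
  nlinarith [hx.four_mul_inner_le hz.1, hz.norm_sub_sq_le hx.1 n, norm_nonneg (q - (x + n))]

lemma abs_inner_le (hx : IsNearestPoint Z (x + (2 : ℝ) • n) x) (hz : IsNearestPoint Z q z) :
    |⟪n, z - x⟫| ≤ 4 * ‖q - (x + n)‖ ^ 2 := by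
  have hle := hx.norm_sub_le hz
  rw [abs_le]
  constructor <;> nlinarith [hx.four_mul_inner_le hz.1, hz.norm_sub_sq_le hx.1 n,
    norm_nonneg (q - (x + n)), norm_nonneg (z - x)]

end IsNearestPoint

end NearestPoint

section Curve

open Asymptotics

variable {E : Type*} [NormedAddCommGroup E] [InnerProductSpace ℝ E] {Z : Set E}
  {a : E → E} {A : E →L[ℝ] E} {p w n : E}

lemma isLittleO_of_add_map_eq {ι : Type*} {l : Filter ι} {e r : ι → E} {μ t : ι → ℝ}
    (hA : ‖A‖ ≤ 1 / 2) (hμ : Tendsto μ l (𝓝 1)) (he : e =O[l] t) (hr : r =o[l] t)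
    (hn : (fun i => ⟪n, e i⟫) =O[l] fun i => t i ^ 2)
    (heq : ∀ᶠ i in l, e i + A (e i) = (1 - μ i) • n + r i) : e =o[l] t := by
  have hrhs : (fun i => (1 - μ i) * ⟪n, e i⟫ + ⟪r i, e i⟫) =o[l] fun i => t i ^ 2 := by
    have hμ' : (fun i => 1 - μ i) =o[l] fun _ => (1 : ℝ) := by
      rw [isLittleO_one_iff]
      simpa using hμ.const_sub 1
    refine IsLittleO.add (by simpa using hμ'.mul_isBigO hn) ?_
    have hprod : (fun i => ‖r i‖ * ‖e i‖) =o[l] fun i => t i ^ 2 := by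
      simpa only [sq] using hr.norm_left.mul_isBigO he.norm_left
    exact IsBigO.trans_isLittleO (.of_norm_le fun i => norm_inner_le_norm _ _) hprod
  have hsq : (fun i => ‖e i‖ ^ 2) =O[l] fun i => (1 - μ i) * ⟪n, e i⟫ + ⟪r i, e i⟫ := by
    refine .of_bound 2 (heq.mono fun i hi => ?_)
    have hid : ‖e i‖ ^ 2 + ⟪A (e i), e i⟫ = (1 - μ i) * ⟪n, e i⟫ + ⟪r i, e i⟫ := by
      rw [← real_inner_self_eq_norm_sq, ← inner_add_left, hi, inner_add_left, real_inner_smul_left]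
    have hAe : |⟪A (e i), e i⟫| ≤ 1 / 2 * ‖e i‖ ^ 2 := by
      rw [sq, ← mul_assoc]
      exact (abs_real_inner_le_norm _ _).trans (by gcongr; exact A.le_of_opNorm_le hA _)
    rw [← hid, Real.norm_eq_abs, Real.norm_eq_abs, abs_of_nonneg (sq_nonneg _)]
    linarith [le_abs_self (‖e i‖ ^ 2 + ⟪A (e i), e i⟫), neg_le_of_abs_le hAe]
  exact ((hsq.trans_isLittleO hrhs).of_pow two_ne_zero).of_norm_left

lemma exists_tendsto_one_of_eq_smul {ι : Type*} {l : Filter ι} {m x : ι → E}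
    (ha : ContinuousAt a p) (hap : a p ≠ 0) (hx : Tendsto x l (𝓝 p)) (hm : Tendsto m l (𝓝 (a p)))
    (hsmul : ∀ᶠ i in l, ∃ μ : ℝ, m i = μ • a (x i)) :
    ∃ μ : ι → ℝ, Tendsto μ l (𝓝 1) ∧ ∀ᶠ i in l, m i = μ i • a (x i) := by
  have hself : ⟪a p, a p⟫ ≠ 0 := inner_self_ne_zero.2 hap
  have hden : Tendsto (fun i => ⟪a p, a (x i)⟫) l (𝓝 ⟪a p, a p⟫) :=
    tendsto_const_nhds.inner (ha.tendsto.comp hx)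
  refine ⟨fun i => ⟪a p, m i⟫ / ⟪a p, a (x i)⟫, ?_, ?_⟩
  · rw [← div_self hself]
    exact (tendsto_const_nhds.inner hm).div hden hself
  · filter_upwards [hsmul, hden.eventually_ne hself] with i ⟨μ, hμ⟩ hne
    rw [hμ, real_inner_smul_right, mul_div_cancel_right₀ μ hne]

lemma exists_isNearestPoint_add_smul [ProperSpace E] (hZ : IsClosed Z)
    (hp : IsNearestPoint Z (p + (2 : ℝ) • n) p) (η : E) :
    ∃ x : ℝ → E, x 0 = p ∧ (∀ t, IsNearestPoint Z (p + n + t • η) (x t)) ∧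
      (fun t => x t - p) =O[𝓝 0] (fun t : ℝ => t) ∧
      (fun t => ⟪n, x t - p⟫) =O[𝓝 0] fun t : ℝ => t ^ 2 := by
  choose x hx using fun t : ℝ => exists_isNearestPoint hZ ⟨p, hp.1⟩ (p + n + t • η)
  have hq (t : ℝ) : ‖p + n + t • η - (p + n)‖ = ‖η‖ * |t| := by
    rw [add_sub_cancel_left, norm_smul, Real.norm_eq_abs, mul_comm]
  refine ⟨x, ?_, hx, ?_, ?_⟩
  · simpa [sub_eq_zero] using hp.norm_sub_le (hx 0)
  · refine .of_bound (4 * ‖η‖) (.of_forall fun t => (hp.norm_sub_le (hx t)).trans_eq ?_)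
    rw [hq, Real.norm_eq_abs, mul_assoc]
  · refine .of_bound (4 * ‖η‖ ^ 2) (.of_forall fun t => (hp.abs_inner_le (hx t)).trans_eq ?_)
    rw [hq, mul_pow, Real.norm_eq_abs, abs_of_nonneg (sq_nonneg t), sq_abs, mul_assoc]

/-- The nearest points to `p + a p + t • (w + A w)` trace the curve: if `q - x = a x` held exactly
at each of them, then `x + a x = p + a p + t • (w + A w)`, hence `x = p + t • w + o(t)`. -/
lemma exists_curve_isNearestPoint [ProperSpace E] (hZ : IsClosed Z) (ha : HasFDerivAt a A p)
    (hA : ‖A‖ ≤ 1 / 2) (hap : a p ≠ 0) (hp : IsNearestPoint Z (p + (2 : ℝ) • a p) p)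
    (hnormal : ∀ᶠ x in 𝓝 p, ∀ q, IsNearestPoint Z q x → ∃ μ : ℝ, q - x = μ • a x)
    (hw : ⟪a p, w⟫ = 0) :
    ∃ (x : ℝ → E) (μ : ℝ → ℝ), x 0 = p ∧ HasDerivAt x w 0 ∧ Tendsto μ (𝓝 0) (𝓝 1) ∧
      ∀ᶠ t in 𝓝 0, IsNearestPoint Z (x t + μ t • a (x t)) (x t) := by
  obtain ⟨x, hx0, hx, hxO, hinner⟩ := exists_isNearestPoint_add_smul hZ hp (w + A w)
  have hxp : Tendsto x (𝓝 0) (𝓝 p) :=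
    tendsto_sub_nhds_zero_iff.1 (hxO.trans_tendsto tendsto_id)
  have hm : Tendsto (fun t : ℝ => p + a p + t • (w + A w) - x t) (𝓝 0) (𝓝 (a p)) := by
    have hq : Tendsto (fun t : ℝ => p + a p + t • (w + A w)) (𝓝 0) (𝓝 (p + a p)) :=
      Continuous.tendsto' (by fun_prop) _ _ (by simp)
    simpa using hq.sub hxp
  obtain ⟨μ, hμ, hsmul⟩ := exists_tendsto_one_of_eq_smul ha.continuousAt hap hxp hm
    ((hxp.eventually hnormal).mono fun t ht => ht _ (hx t))
  set ρ : ℝ → E := fun t => a (x t) - a p - A (x t - p)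
  have hρ : ρ =o[𝓝 0] fun t : ℝ => t := (ha.isLittleO.comp_tendsto hxp).trans_isBigO hxO
  have hr : (fun t => (1 - μ t) • A (x t - p) - μ t • ρ t) =o[𝓝 0] fun t : ℝ => t := by
    have hμ' : (fun t => 1 - μ t) =o[𝓝 0] fun _ => (1 : ℝ) := by
      rw [isLittleO_one_iff]
      simpa using hμ.const_sub 1
    simpa using (hμ'.smul_isBigO ((A.isBigO_comp _ _).trans hxO)).sub
      ((hμ.isBigO_one ℝ).smul_isLittleO hρ)
  refine ⟨x, μ, hx0, ?_, hμ, hsmul.mono fun t ht => ?_⟩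
  · rw [hasDerivAt_iff_isLittleO]
    simp only [sub_zero, hx0]
    refine isLittleO_of_add_map_eq (n := a p) hA hμ ?_ hr ?_ ?_
    · exact hxO.sub (.of_bound ‖w‖ (.of_forall fun t => by rw [norm_smul, mul_comm]))
    · simpa [inner_sub_right, inner_smul_right, hw] using hinner
    · filter_upwards [hsmul] with t ht
      have : a (x t) = a p + A (x t - p) + ρ t := by simp only [ρ]; abel
      simp only [this, map_sub, map_smul] at ht ⊢
      linear_combination (norm := module) (-1 : ℝ) • ht
  · rw [← ht, add_sub_cancel]
    exact hx t

end Curve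

section Polygon

variable {E : Type*} [NormedAddCommGroup E] [InnerProductSpace ℝ E] {Z : Set E}
  {a : E → E} {A : E →L[ℝ] E} {p : E}

lemma IsNearestPoint.inner_le {x z n : E} {μ : ℝ} (h : IsNearestPoint Z (x + μ • n) x)
    (hμ : 0 < μ) (hz : z ∈ Z) : ⟪n, z - x⟫ ≤ (2 * μ)⁻¹ * ‖z - x‖ ^ 2 := by
  have hle := (isNearestPoint_iff.1 h).2 z hz
  rw [add_sub_cancel_left, real_inner_smul_left] at hle
  field_simp
  linarith

/-- Summed around a closed polygon in `Z`, the inequalities `⟪a x, z - x⟫ ≤ ‖z - x‖ ^ 2 / (2 * μ)`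
lose their first-order part by telescoping, and the second-order part is the claim. -/
lemma sum_inner_map_sub_le (ha : HasFDerivAt a A p)
    (hcurve : ∀ w, ⟪a p, w⟫ = 0 → ∃ (x : ℝ → E) (μ : ℝ → ℝ), x 0 = p ∧ HasDerivAt x w 0 ∧
      Tendsto μ (𝓝 0) (𝓝 1) ∧ ∀ᶠ t in 𝓝 0, IsNearestPoint Z (x t + μ t • a (x t)) (x t))
    {w : ℕ → E} {N : ℕ} (hw : ∀ i, ⟪a p, w i⟫ = 0) (hwN : w N = w 0) :
    ∑ i ∈ Finset.range N, ⟪A (w i), w (i + 1) - w i⟫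
      ≤ ∑ i ∈ Finset.range N, 2⁻¹ * ‖w (i + 1) - w i‖ ^ 2 := by
  choose! x μ hx0 hxw hμ hx using hcurve
  set X : ℕ → ℝ → E := fun i => x (w i)
  set D : ℕ → ℝ → E := fun i t => t⁻¹ • (X (i + 1) t - X i t)
  set G : ℕ → ℝ → E := fun i t => t⁻¹ • (a (X i t) - a p)
  have hD (i : ℕ) : Tendsto (D i) (𝓝[≠] 0) (𝓝 (w (i + 1) - w i)) := by
    have := hasDerivAt_iff_tendsto_slope_zero.1 ((hxw _ (hw (i + 1))).sub (hxw _ (hw i)))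
    simpa [hx0 _ (hw _)] using this
  have hG (i : ℕ) : Tendsto (G i) (𝓝[≠] 0) (𝓝 (A (w i))) := by
    have := hasDerivAt_iff_tendsto_slope_zero.1
      (HasFDerivAt.comp_hasDerivAt_of_eq 0 ha (hxw _ (hw i)) (hx0 _ (hw i)).symm)
    simpa [hx0 _ (hw _)] using this
  have hle (i : ℕ) : ∀ᶠ t in 𝓝[≠] 0, ⟪G i t, D i t⟫ +
      t⁻¹ ^ 2 * (⟪a p, X (i + 1) t⟫ - ⟪a p, X i t⟫) ≤ (2 * μ (w i) t)⁻¹ * ‖D i t‖ ^ 2 := by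
    filter_upwards [nhdsWithin_le_nhds (hx _ (hw i)), nhdsWithin_le_nhds (hx _ (hw (i + 1))),
      nhdsWithin_le_nhds ((hμ _ (hw i)).eventually_const_lt one_pos)] with t hi hi' hμt
    have := mul_le_mul_of_nonneg_left (hi.inner_le hμt hi'.1) (sq_nonneg t⁻¹)
    simp only [G, D, real_inner_smul_left, real_inner_smul_right, inner_sub_left, norm_smul,
      mul_pow, Real.norm_eq_abs, sq_abs]
    simp only [inner_sub_right] at this ⊢
    linarith
  have hsum : ∀ᶠ t in 𝓝[≠] 0, ∑ i ∈ Finset.range N, ⟪G i t, D i t⟫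
      ≤ ∑ i ∈ Finset.range N, (2 * μ (w i) t)⁻¹ * ‖D i t‖ ^ 2 := by
    filter_upwards [(Finset.range N).eventually_all.2 fun i _ => hle i] with t ht
    have := Finset.sum_le_sum ht
    rwa [Finset.sum_add_distrib, ← Finset.mul_sum,
      Finset.sum_range_sub (fun i => ⟪a p, X i t⟫), show X N = X 0 by simp only [X, hwN],
      sub_self, mul_zero, add_zero] at this
  refine le_of_tendsto_of_tendsto (tendsto_finsetSum _ fun i _ => (hG i).inner (hD i))
    (tendsto_finsetSum _ fun i _ => ?_) hsum
  have hμi := ((hμ _ (hw i)).mono_left (nhdsWithin_le_nhds (s := {0}ᶜ))).const_mul 2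
  exact ((mul_one (2 : ℝ) ▸ hμi).inv₀ two_ne_zero).mul ((hD i).norm.pow 2)

/-- The point with parameter `θ` on the ellipse with conjugate semi-axes `ξ` and `ζ`. -/
noncomputable def ellipsePoint (ξ ζ : E) (θ : ℝ) : E := Real.cos θ • ξ + Real.sin θ • ζ

lemma ellipsePoint_mem {T : Submodule ℝ E} {ξ ζ : E} (hξ : ξ ∈ T) (hζ : ζ ∈ T) (θ : ℝ) :
    ellipsePoint ξ ζ θ ∈ T :=
  T.add_mem (T.smul_mem _ hξ) (T.smul_mem _ hζ)

lemma norm_ellipsePoint_sub_le (ξ ζ : E) (α β : ℝ) :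
    ‖ellipsePoint ξ ζ β - ellipsePoint ξ ζ α‖ ≤ |β - α| * (‖ξ‖ + ‖ζ‖) := by
  have hsplit : ellipsePoint ξ ζ β - ellipsePoint ξ ζ α
      = (Real.cos β - Real.cos α) • ξ + (Real.sin β - Real.sin α) • ζ := by
    simp only [ellipsePoint]
    module
  rw [hsplit, mul_add]
  refine (norm_add_le _ _).trans ?_
  rw [norm_smul, norm_smul, Real.norm_eq_abs, Real.norm_eq_abs]
  exact add_le_add (mul_le_mul_of_nonneg_right (Real.abs_cos_sub_cos_le β α) (norm_nonneg _))
    (mul_le_mul_of_nonneg_right (Real.abs_sin_sub_sin_le β α) (norm_nonneg _))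

lemma inner_map_ellipsePoint_sub (ξ ζ : E) (α β : ℝ) :
    ⟪A (ellipsePoint ξ ζ α), ellipsePoint ξ ζ β⟫ - ⟪A (ellipsePoint ξ ζ β), ellipsePoint ξ ζ α⟫
      = Real.sin (β - α) * (⟪A ξ, ζ⟫ - ⟪A ζ, ξ⟫) := by
  simp only [ellipsePoint, map_add, map_smul, inner_add_left, inner_add_right,
    real_inner_smul_left, real_inner_smul_right, Real.sin_sub]
  ring

lemma inner_map_sub_inner_map_le (C : ℝ) (x y : E) :
    ⟪A x, y⟫ - ⟪A y, x⟫ ≤ 2 * (⟪A x, y - x⟫ - C * ‖y - x‖ ^ 2) - (⟪A y, y⟫ - ⟪A x, x⟫)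
      + (2 * |C| + ‖A‖) * ‖y - x‖ ^ 2 := by
  have hid : 2 * ⟪A x, y - x⟫
      = (⟪A y, y⟫ - ⟪A x, x⟫) - ⟪A (y - x), y - x⟫ + (⟪A x, y⟫ - ⟪A y, x⟫) := by
    simp only [map_sub, inner_sub_left, inner_sub_right]
    ring
  have hA : ⟪A (y - x), y - x⟫ ≤ ‖A‖ * ‖y - x‖ ^ 2 := by
    rw [sq, ← mul_assoc]
    exact (real_inner_le_norm _ _).trans (by gcongr; exact A.le_opNorm _)
  have hC : C * ‖y - x‖ ^ 2 ≤ |C| * ‖y - x‖ ^ 2 := by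
    gcongr
    exact le_abs_self C
  linarith

/-- The polygon is inscribed in the ellipse spanned by `ξ` and `ζ`. -/
lemma sin_mul_inner_map_sub_le_of_sum_polygon_le {T : Submodule ℝ E} {C θ : ℝ} {N : ℕ} {ξ ζ : E}
    (h : ∀ w : ℕ → E, (∀ i, w i ∈ T) → w N = w 0 →
      ∑ i ∈ Finset.range N, ⟪A (w i), w (i + 1) - w i⟫
        ≤ ∑ i ∈ Finset.range N, C * ‖w (i + 1) - w i‖ ^ 2)
    (hξ : ξ ∈ T) (hζ : ζ ∈ T) (hN : 0 < N) (hθ : N * θ = 2 * Real.pi) :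
    Real.sin θ * (⟪A ξ, ζ⟫ - ⟪A ζ, ξ⟫) ≤ (2 * |C| + ‖A‖) * (‖ξ‖ + ‖ζ‖) ^ 2 * θ ^ 2 := by
  set w : ℕ → E := fun i => ellipsePoint ξ ζ (i * θ)
  have hwN : w N = w 0 := by simp [w, ellipsePoint, hθ]
  have hstep (i : ℕ) : ((i + 1 : ℕ) : ℝ) * θ - i * θ = θ := by push_cast; ring
  have hnorm (i : ℕ) : ‖w (i + 1) - w i‖ ^ 2 ≤ (‖ξ‖ + ‖ζ‖) ^ 2 * θ ^ 2 := by
    have := norm_ellipsePoint_sub_le ξ ζ (i * θ) ((i + 1 : ℕ) * θ)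
    rw [hstep] at this
    rw [← sq_abs θ, ← mul_pow, mul_comm _ |θ|]
    exact pow_le_pow_left₀ (norm_nonneg _) this 2
  have hterm (i : ℕ) : Real.sin θ * (⟪A ξ, ζ⟫ - ⟪A ζ, ξ⟫)
        - (2 * |C| + ‖A‖) * (‖ξ‖ + ‖ζ‖) ^ 2 * θ ^ 2
      ≤ 2 * (⟪A (w i), w (i + 1) - w i⟫ - C * ‖w (i + 1) - w i‖ ^ 2)
        - (⟪A (w (i + 1)), w (i + 1)⟫ - ⟪A (w i), w i⟫) := by
    have hcross := inner_map_ellipsePoint_sub (A := A) ξ ζ (i * θ) ((i + 1 : ℕ) * θ)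
    rw [hstep] at hcross
    have hK : 0 ≤ 2 * |C| + ‖A‖ := by positivity
    linarith [inner_map_sub_inner_map_le (A := A) C (w i) (w (i + 1)),
      mul_le_mul_of_nonneg_left (hnorm i) hK]
  have hsum := Finset.sum_le_sum fun i (_ : i ∈ Finset.range N) => hterm i
  rw [Finset.sum_const, Finset.card_range, nsmul_eq_mul, Finset.sum_sub_distrib,
    Finset.sum_range_sub (fun i => ⟪A (w i), w i⟫), hwN, ← Finset.mul_sum,
    Finset.sum_sub_distrib] at hsum
  have hpos : (0 : ℝ) < N := by exact_mod_cast hN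
  nlinarith [h w (fun i => ellipsePoint_mem hξ hζ _) hwN]

/-- Inscribed `N`-gons: `N * sin (2 * π / N)` has a positive limit and `N * (2 * π / N) ^ 2`
tends to zero. -/
lemma inner_map_le_of_sum_polygon_le {T : Submodule ℝ E} {C : ℝ}
    (h : ∀ (N : ℕ) (w : ℕ → E), (∀ i, w i ∈ T) → w N = w 0 →
      ∑ i ∈ Finset.range N, ⟪A (w i), w (i + 1) - w i⟫
        ≤ ∑ i ∈ Finset.range N, C * ‖w (i + 1) - w i‖ ^ 2)
    {ξ ζ : E} (hξ : ξ ∈ T) (hζ : ζ ∈ T) : ⟪A ξ, ζ⟫ ≤ ⟪A ζ, ξ⟫ := by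
  rw [← sub_nonpos]
  set K := (2 * |C| + ‖A‖) * (‖ξ‖ + ‖ζ‖) ^ 2
  have hθ : Tendsto (fun N : ℕ => 2 * Real.pi / N) atTop (𝓝[≠] 0) :=
    tendsto_nhdsWithin_iff.2 ⟨tendsto_const_div_atTop_nhds_zero_nat _,
      (eventually_gt_atTop 0).mono fun N hN => by
        have : (N : ℝ) ≠ 0 := by positivity
        simp [Real.pi_ne_zero, this]⟩
  have hsinc : Tendsto (fun θ : ℝ => Real.sinc θ * (⟪A ξ, ζ⟫ - ⟪A ζ, ξ⟫)) (𝓝 0)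
      (𝓝 (⟪A ξ, ζ⟫ - ⟪A ζ, ξ⟫)) :=
    Continuous.tendsto' (by fun_prop) _ _ (by simp)
  have hK : Tendsto (fun θ : ℝ => K * θ) (𝓝 0) (𝓝 0) :=
    Continuous.tendsto' (by fun_prop) _ _ (by simp)
  refine le_of_tendsto_of_tendsto ((hsinc.mono_left nhdsWithin_le_nhds).comp hθ)
    ((hK.mono_left nhdsWithin_le_nhds).comp hθ) ?_
  filter_upwards [eventually_gt_atTop 0] with N hN
  have hNθ : (N : ℝ) * (2 * Real.pi / N) = 2 * Real.pi := by field_simp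
  have hpos : 0 < 2 * Real.pi / N := by positivity
  have hle := sin_mul_inner_map_sub_le_of_sum_polygon_le (h N) hξ hζ hN hNθ
  simp only [Function.comp_apply, Real.sinc_of_ne_zero hpos.ne']
  rw [div_mul_eq_mul_div, div_le_iff₀ hpos]
  linarith

lemma inner_map_comm_of_sum_polygon_le {T : Submodule ℝ E} {C : ℝ}
    (h : ∀ (N : ℕ) (w : ℕ → E), (∀ i, w i ∈ T) → w N = w 0 →
      ∑ i ∈ Finset.range N, ⟪A (w i), w (i + 1) - w i⟫
        ≤ ∑ i ∈ Finset.range N, C * ‖w (i + 1) - w i‖ ^ 2)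
    {ξ ζ : E} (hξ : ξ ∈ T) (hζ : ζ ∈ T) : ⟪A ξ, ζ⟫ = ⟪A ζ, ξ⟫ :=
  (inner_map_le_of_sum_polygon_le h hξ hζ).antisymm (inner_map_le_of_sum_polygon_le h hζ hξ)

lemma inner_map_comm_of_norm_le_half [ProperSpace E] (hZ : IsClosed Z) (ha : HasFDerivAt a A p)
    (hA : ‖A‖ ≤ 1 / 2) (hap : a p ≠ 0) (hp : IsNearestPoint Z (p + (2 : ℝ) • a p) p)
    (hnormal : ∀ᶠ x in 𝓝 p, ∀ q, IsNearestPoint Z q x → ∃ μ : ℝ, q - x = μ • a x)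
    {ξ ζ : E} (hξ : ⟪a p, ξ⟫ = 0) (hζ : ⟪a p, ζ⟫ = 0) : ⟪A ξ, ζ⟫ = ⟪A ζ, ξ⟫ := by
  have hcurve := fun w => exists_curve_isNearestPoint (w := w) hZ ha hA hap hp hnormal
  simp only [← Submodule.mem_orthogonal_singleton_iff_inner_right] at hξ hζ hcurve
  refine inner_map_comm_of_sum_polygon_le (T := (ℝ ∙ a p)ᗮ) (C := 2⁻¹) (fun N w hw hwN => ?_) hξ hζ
  simp only [Submodule.mem_orthogonal_singleton_iff_inner_right] at hw hcurve
  exact sum_inner_map_sub_le ha hcurve hw hwN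

/-- The conclusion is the Frobenius integrability condition at `p` for the hyperplane field
orthogonal to `a`. -/
theorem IsNearestPoint.inner_fderiv_comm [ProperSpace E] {q : E} (hZ : IsClosed Z)
    (ha : HasFDerivAt a A p) (hqp : q ≠ p) (hp : IsNearestPoint Z q p)
    (hnormal : ∀ᶠ x in 𝓝 p, ∀ q, IsNearestPoint Z q x → ∃ μ : ℝ, q - x = μ • a x)
    {ξ ζ : E} (hξ : ⟪a p, ξ⟫ = 0) (hζ : ⟪a p, ζ⟫ = 0) : ⟪A ξ, ζ⟫ = ⟪A ζ, ξ⟫ := by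
  obtain ⟨μ, hμ⟩ := hnormal.self_of_nhds q hp
  obtain ⟨hμ0, hap⟩ : μ ≠ 0 ∧ a p ≠ 0 := smul_ne_zero_iff.1 (hμ ▸ sub_ne_zero.2 hqp)
  set s : ℝ := (1 + |μ| * ‖A‖)⁻¹
  have hs : 0 < s := by positivity
  have hs₁ : s ≤ 1 := inv_le_one_of_one_le₀ (by linarith [show 0 ≤ |μ| * ‖A‖ by positivity])
  set κ := s * μ / 2
  have hκ : κ ≠ 0 := by positivity
  have hκA : ‖κ • A‖ ≤ 1 / 2 := by
    have : s * (1 + |μ| * ‖A‖) = 1 := inv_mul_cancel₀ (by positivity)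
    rw [norm_smul, Real.norm_eq_abs, abs_div, abs_mul, abs_of_pos hs, abs_two]
    linarith
  have hp' : IsNearestPoint Z (p + (2 : ℝ) • κ • a p) p := by
    rw [← add_sub_cancel p q, hμ] at hp
    convert hp.add_smul hs.le hs₁ using 2
    simp only [κ]
    module
  have hcomm := inner_map_comm_of_norm_le_half (a := κ • a) hZ (ha.const_smul κ) hκA
    (smul_ne_zero hκ hap) hp' ?_ (ξ := ξ) (ζ := ζ) ?_ ?_
  · simpa [real_inner_smul_left, hκ] using hcomm
  · filter_upwards [hnormal] with x hx q hq
    obtain ⟨μ, hμ⟩ := hx q hq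
    exact ⟨μ / κ, by rw [hμ, Pi.smul_apply, smul_smul, div_mul_cancel₀ _ hκ]⟩
  · simp [real_inner_smul_left, hξ]
  · simp [real_inner_smul_left, hζ]

end Polygon

section Curvature

lemma exists_map_fderiv_comp_sub_le {D E G : Type*} [NormedAddCommGroup D] [NormedSpace ℝ D]
    [NormedAddCommGroup E] [NormedSpace ℝ E] [NormedAddCommGroup G] [NormedSpace ℝ G]
    (T : (D →L[ℝ] G) →L[ℝ] ℝ) {ν : E → G} {a b : D → E} {p : D} (hν : ContDiffAt ℝ 2 ν (a p))
    (ha : ContDiffAt ℝ 1 a p) (hb : ContDiffAt ℝ 1 b p) (hab : a p = b p)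
    (hle : ∀ᶠ x in 𝓝 p, T (fderiv ℝ (ν ∘ a) x) ≤ T (fderiv ℝ (ν ∘ b) x)) :
    ∃ C : ℝ, ∀ᶠ x in 𝓝 p,
      T (fderiv ℝ ν (a x) ∘L (fderiv ℝ a x - fderiv ℝ b x)) ≤ C * ‖a x - b x‖ := by
  obtain ⟨K, s, hs, hK⟩ :=
    (hν.fderiv_right (m := 1) (by norm_num)).exists_lipschitzOnWith
  have hνd : ∀ᶠ y in 𝓝 (a p), DifferentiableAt ℝ ν y :=
    (hν.eventually (by simp)).mono fun y hy => hy.differentiableAt two_ne_zero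
  have hb' : ContinuousAt (fderiv ℝ b) p := (hb.fderiv_right (m := 0) (by norm_num)).continuousAt
  have hbp : Tendsto b (𝓝 p) (𝓝 (a p)) := hab ▸ hb.continuousAt
  set B := ‖fderiv ℝ b p‖ + 1
  refine ⟨‖T‖ * (K * B), ?_⟩
  filter_upwards [hle, ha.continuousAt.eventually hs, hbp.eventually hs,
    ha.continuousAt.eventually hνd, hbp.eventually hνd, ha.eventually (by simp),
    hb.eventually (by simp), hb'.norm.eventually_lt_const (lt_add_one _)]
    with x hx has hbs haν hbν hax hbx hB
  rw [fderiv_comp x haν (hax.differentiableAt one_ne_zero),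
    fderiv_comp x hbν (hbx.differentiableAt one_ne_zero)] at hx
  calc T (fderiv ℝ ν (a x) ∘L (fderiv ℝ a x - fderiv ℝ b x))
      ≤ T ((fderiv ℝ ν (b x) - fderiv ℝ ν (a x)) ∘L fderiv ℝ b x) := by
        rw [ContinuousLinearMap.comp_sub, ContinuousLinearMap.sub_comp, map_sub, map_sub]
        linarith
    _ ≤ ‖T‖ * (‖fderiv ℝ ν (b x) - fderiv ℝ ν (a x)‖ * ‖fderiv ℝ b x‖) :=
        (le_abs_self _).trans (T.le_opNorm_of_le (ContinuousLinearMap.opNorm_comp_le _ _))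
    _ ≤ ‖T‖ * ((K * ‖b x - a x‖) * B) := by
        gcongr
        exact hK.norm_sub_le hbs has
    _ = ‖T‖ * (K * B) * ‖a x - b x‖ := by
        rw [norm_sub_rev]
        ring

variable {m : ℕ} {F : EuclideanSpace ℝ (Fin m) → EuclideanSpace ℝ (Fin m)}
  {u v : EuclideanSpace ℝ (Fin m) → ℝ} {x q : EuclideanSpace ℝ (Fin m)}
  {K : Set (EuclideanSpace ℝ (Fin m))}

lemma divergence_eq_traceCLM (V : EuclideanSpace ℝ (Fin m) → EuclideanSpace ℝ (Fin m))
    (x : EuclideanSpace ℝ (Fin m)) :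
    divergence V x = traceCLM (EuclideanSpace ℝ (Fin m)) (fderiv ℝ V x) := by
  rw [traceCLM_apply, LinearMap.trace_eq_sum_inner _ (EuclideanSpace.basisFun (Fin m) ℝ)]
  simp [divergence, EuclideanSpace.inner_single_left]

lemma horizontalMeanCurvature_eq_traceCLM
    (F : EuclideanSpace ℝ (Fin m) → EuclideanSpace ℝ (Fin m)) (u : EuclideanSpace ℝ (Fin m) → ℝ)
    (x : EuclideanSpace ℝ (Fin m)) :
    horizontalMeanCurvature F u x
      = traceCLM _ (fderiv ℝ (𝐧 ∘ fun y => gradient u y + F y) x) :=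
  divergence_eq_traceCLM _ x

lemma gradient_eq_of_touching (hu : DifferentiableAt ℝ u x) (hv : DifferentiableAt ℝ v x)
    (hvu : ∀ᶠ y in 𝓝 x, v y ≤ u y) (hx : u x = v x) : gradient u x = gradient v x := by
  rw [← sub_eq_zero, ← gradient_sub hu hv]
  refine gradient_eq_zero_of_isLocalMin (hvu.mono fun y hy => ?_)
  simpa only [hx, sub_self, sub_nonneg] using hy

lemma exists_traceCLM_comp_hessian_sub_le (hu : ContDiffAt ℝ 2 u x) (hv : ContDiffAt ℝ 2 v x)
    (hF : ContDiffAt ℝ 1 F x) (hux : gradient u x + F x ≠ 0) (hgrad : gradient u x = gradient v x)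
    (hH : ∀ᶠ y in 𝓝 x, gradient v y + F y ≠ 0 →
      horizontalMeanCurvature F u y ≤ horizontalMeanCurvature F v y) :
    ∃ C : ℝ, ∀ᶠ y in 𝓝 x,
      traceCLM _ (fderiv ℝ 𝐧 (gradient u y + F y) ∘L hessian (fun z => u z - v z) y)
        ≤ C * ‖gradient (fun z => u z - v z) y‖ := by
  have ha : ContDiffAt ℝ 1 (fun y => gradient u y + F y) x := (contDiffAt_gradient hu).add hF
  have hb : ContDiffAt ℝ 1 (fun y => gradient v y + F y) x := (contDiffAt_gradient hv).add hF
  have hb0 : ∀ᶠ y in 𝓝 x, gradient v y + F y ≠ 0 := hb.continuousAt.eventually_ne (hgrad ▸ hux)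
  obtain ⟨C, hC⟩ := exists_map_fderiv_comp_sub_le (traceCLM (EuclideanSpace ℝ (Fin m)))
    (a := fun y => gradient u y + F y) (contDiffAt_normalize hux) ha hb
    (congrArg (· + F x) hgrad) <| by
      filter_upwards [hH, hb0] with y hy hy0
      simpa only [horizontalMeanCurvature_eq_traceCLM] using hy hy0
  refine ⟨C, ?_⟩
  filter_upwards [hC, hu.eventually (by simp), hv.eventually (by simp), hF.eventually (by simp)]
    with y hy huy hvy hFy
  have hFd := (hFy.differentiableAt one_ne_zero).hasFDerivAt
  rwa [((hasFDerivAt_gradient huy).fun_add hFd).fderiv,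
    ((hasFDerivAt_gradient hvy).fun_add hFd).fderiv, add_sub_add_right_eq_sub,
    add_sub_add_right_eq_sub, ← hessian_sub huy hvy, ← gradient_sub
      (huy.differentiableAt two_ne_zero) (hvy.differentiableAt two_ne_zero)] at hy

/-- Hopf's boundary point lemma at `x`: a proximal normal of the contact set must lie in the kernel
of the principal symbol `D𝐧 (∇u + F)`, which is spanned by `∇u + F`. -/
lemma exists_sub_eq_smul_of_touching (hu : ContDiffAt ℝ 2 u x) (hv : ContDiffAt ℝ 2 v x)
    (hF : ContDiffAt ℝ 1 F x) (hux : gradient u x + F x ≠ 0)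
    (hH : ∀ᶠ y in 𝓝 x, gradient v y + F y ≠ 0 →
      horizontalMeanCurvature F u y ≤ horizontalMeanCurvature F v y)
    (hvu : ∀ᶠ y in 𝓝 x, v y ≤ u y) (hx : u x = v x)
    (hK : ∀ᶠ y in 𝓝 x, u y = v y → y ∈ K) (hq : IsNearestPoint K q x) :
    ∃ μ : ℝ, q - x = μ • (gradient u x + F x) := by
  have hgrad := gradient_eq_of_touching (hu.differentiableAt two_ne_zero)
    (hv.differentiableAt two_ne_zero) hvu hx
  obtain ⟨C, hC⟩ := exists_traceCLM_comp_hessian_sub_le hu hv hF hux hgrad hH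
  have ha : ContinuousAt (fun y => gradient u y + F y) x :=
    (contDiffAt_gradient hu).continuousAt.add hF.continuousAt
  have hsymbol : ContinuousAt (fun y => fderiv ℝ 𝐧 (gradient u y + F y)) x :=
    ContinuousAt.comp (f := fun y => gradient u y + F y)
      ((contDiffAt_normalize (n := 1) hux).fderiv_right (m := 0) (by norm_num)).continuousAt ha
  have hnonpos := inner_nonpos_of_touching_closedBall (c := midpoint ℝ x q) hsymbol
    ((ha.eventually_ne hux).mono fun y => isPositive_fderiv_normalize) (hu.sub hv) hC
    (hvu.mono fun y => sub_nonneg.2) (sub_eq_zero.2 hx) <| by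
      filter_upwards [hvu, hK] with y hy hyK hne hball
      refine sub_pos.2 (hy.lt_of_ne fun heq => hne ?_)
      exact hq.eq_of_mem_closedBall_midpoint (hyK heq.symm) hball
  rw [real_inner_comm] at hnonpos
  obtain ⟨μ, hμ⟩ := exists_eq_smul_of_inner_fderiv_normalize_nonpos hux hnonpos
  refine ⟨-2 * μ, ?_⟩
  rw [mul_smul, ← hμ, left_sub_midpoint, invOf_eq_inv]
  module

lemma mem_nhds_setOf_eq_of_horizontalMeanCurvature_le {U : Set (EuclideanSpace ℝ (Fin m))}
    (hU : IsOpen U) (hu : ContDiffOn ℝ 2 u U) (hv : ContDiffOn ℝ 2 v U) (hF : ContDiffOn ℝ 1 F U)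
    (hu0 : ∀ x ∈ U, gradient u x + F x ≠ 0)
    (hcurl : ∀ x ∈ U, ∀ a, ∃ ξ ζ, ⟪a, ξ⟫ = 0 ∧ ⟪a, ζ⟫ = 0 ∧
      ⟪fderiv ℝ F x ξ, ζ⟫ ≠ ⟪fderiv ℝ F x ζ, ξ⟫)
    (hH : ∀ x ∈ U, gradient v x + F x ≠ 0 →
      horizontalMeanCurvature F u x ≤ horizontalMeanCurvature F v x)
    (hvu : ∀ x ∈ U, v x ≤ u x) (hx : x ∈ U) (hux : u x = v x) : {y | u y = v y} ∈ 𝓝 x := by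
  obtain ⟨r, hr, hrU⟩ := Metric.nhds_basis_closedBall.mem_iff.1 (hU.mem_nhds hx)
  set K := {y ∈ closedBall x r | u y = v y}
  have hK : IsClosed K := isClosed_closedBall.isClosed_eq (hu.continuousOn.mono hrU)
    (hv.continuousOn.mono hrU)
  by_contra hnhds
  obtain ⟨p, hpr, q, hqp, hq⟩ := exists_isNearestPoint_mem_of_notMem_nhds hK
    ⟨mem_closedBall_self hr.le, hux⟩ (fun h => hnhds (mem_of_superset h fun y hy => hy.2))
    (ball_mem_nhds x hr)
  have hpU := hrU hq.1.1
  have hup := hu.contDiffAt (hU.mem_nhds hpU)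
  have hFp := hF.contDiffAt (hU.mem_nhds hpU)
  have hnormal : ∀ᶠ y in 𝓝 p, ∀ q, IsNearestPoint K q y →
      ∃ μ : ℝ, q - y = μ • (gradient u y + F y) := by
    filter_upwards [isOpen_ball.mem_nhds hpr] with y hyr q hq
    have hyU := hU.mem_nhds (hrU hq.1.1)
    refine exists_sub_eq_smul_of_touching (hu.contDiffAt hyU) (hv.contDiffAt hyU)
      (hF.contDiffAt hyU) (hu0 y (hrU hq.1.1)) (mem_of_superset hyU hH) (mem_of_superset hyU hvu)
      hq.1.2 ?_ hq
    filter_upwards [isOpen_ball.mem_nhds hyr] with z hz huz using ⟨ball_subset_closedBall hz, huz⟩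
  have hderiv := (hasFDerivAt_gradient hup).fun_add (hFp.differentiableAt one_ne_zero).hasFDerivAt
  obtain ⟨ξ, ζ, hξ, hζ, hne⟩ := hcurl p hpU (gradient u p + F p)
  refine hne ?_
  simpa only [add_apply, inner_add_left, inner_hessian_comm hup ξ ζ,
    add_right_inj] using hq.inner_fderiv_comm hK hderiv hqp hnormal hξ hζ

/-- The curl condition says that the two-form `d(∑ i, F i * dx i)` does not vanish on any
hyperplane. -/
theorem corollaryI_general {U : Set (EuclideanSpace ℝ (Fin m))}
    {p₀ : EuclideanSpace ℝ (Fin m)} (hu : ContDiffOn ℝ 2 u U) (hv : ContDiffOn ℝ 2 v U)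
    (hF : ContDiffOn ℝ 1 F U) (hnonsing : IsNonsingularDomain F u U)
    (hcurl : ∀ x ∈ U, ∀ a, ∃ ξ ζ, ⟪a, ξ⟫ = 0 ∧ ⟪a, ζ⟫ = 0 ∧
      ⟪fderiv ℝ F x ξ, ζ⟫ ≠ ⟪fderiv ℝ F x ζ, ξ⟫)
    (hH : ∀ x ∈ U, gradient v x + F x ≠ 0 →
      horizontalMeanCurvature F u x ≤ horizontalMeanCurvature F v x)
    (hvu : ∀ x ∈ U, v x ≤ u x) (hp₀ : p₀ ∈ U) (hup₀ : u p₀ = v p₀) : EqOn u v U := by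
  obtain ⟨hU, hconn, hu0⟩ := hnonsing
  set S := {y | u y = v y}
  have hS : interior S ⊆ S := interior_subset
  have hopen (x) (hx : x ∈ U) (hux : x ∈ S) : x ∈ interior S := mem_interior_iff_mem_nhds.2
    (mem_nhds_setOf_eq_of_horizontalMeanCurvature_le hU hu hv hF hu0 hcurl hH hvu hx hux)
  have hclosure : closure (interior S) ∩ U ⊆ interior S := by
    rintro x ⟨hx, hxU⟩
    refine hopen x hxU (by_contra fun hne => ?_)
    have hnear := ((hu.continuousOn.continuousAt (hU.mem_nhds hxU)).ne_iff_eventually_ne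
      (hv.continuousOn.continuousAt (hU.mem_nhds hxU))).1 hne
    exact mem_closure_iff_frequently.1 hx (hnear.mono fun y hy hyS => hy (hS hyS))
  have hsub : U ⊆ interior S := hconn.isPreconnected.subset_of_closure_inter_subset
    isOpen_interior ⟨p₀, hp₀, hopen p₀ hp₀ hup₀⟩ hclosure
  exact fun x hx => hS (hsub hx)

end Curvature

section Heisenberg

lemma exists_ne_zero_inner_eq_zero {E : Type*} [NormedAddCommGroup E] [InnerProductSpace ℝ E]
    [FiniteDimensional ℝ E] (hE : 2 < Module.finrank ℝ E) (a b : E) :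
    ∃ ξ ≠ 0, ⟪a, ξ⟫ = 0 ∧ ⟪b, ξ⟫ = 0 := by
  have hker := LinearMap.ker_ne_bot_of_finrank_lt
    (f := ((innerSL ℝ a).prod (innerSL ℝ b)).toLinearMap) (by simpa using hE)
  obtain ⟨ξ, hξ, hξ0⟩ := Submodule.exists_mem_ne_zero_of_ne_bot hker
  exact ⟨ξ, hξ0, Prod.ext_iff.1 hξ⟩

lemma exists_inner_map_ne_of_skew {E : Type*} [NormedAddCommGroup E] [InnerProductSpace ℝ E]
    [FiniteDimensional ℝ E] (hE : 2 < Module.finrank ℝ E) {J : E →ₗ[ℝ] E}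
    (hskew : ∀ x y, ⟪J x, y⟫ = -⟪x, J y⟫) (hinj : Function.Injective J) (a : E) :
    ∃ ξ ζ, ⟪a, ξ⟫ = 0 ∧ ⟪a, ζ⟫ = 0 ∧ ⟪J ξ, ζ⟫ ≠ ⟪J ζ, ξ⟫ := by
  obtain ⟨ξ, hξ0, haξ, hJaξ⟩ := exists_ne_zero_inner_eq_zero hE a (J a)
  refine ⟨ξ, J ξ, haξ, by linarith [hskew a ξ], ?_⟩
  have : 0 < ⟪J ξ, J ξ⟫ := real_inner_self_pos.2 ((map_ne_zero_iff J hinj).2 hξ0)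
  rw [hskew (J ξ) ξ]
  linarith

/-- The involution exchanging the indices `2 * j` and `2 * j + 1`, which are those of conjugate
coordinates. -/
def pairSwap {n : ℕ} (i : Fin (2 * n)) : Fin (2 * n) :=
  if h : i.val % 2 = 0 then ⟨i.val + 1, by have := i.isLt; omega⟩
  else ⟨i.val - 1, by have := i.isLt; omega⟩

/-- The sign with which the coordinate `pairSwap i` enters the `i`-th component of
`heisenbergField`. -/
def pairSign {n : ℕ} (i : Fin (2 * n)) : ℝ := if i.val % 2 = 0 then -1 else 1

variable {n : ℕ}

lemma pairSwap_involutive : Function.Involutive (pairSwap (n := n)) := by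
  intro i
  ext
  by_cases h : i.val % 2 = 0
  · have h' : (i.val + 1) % 2 ≠ 0 := by omega
    simp [pairSwap, h, h']
  · have h' : (i.val - 1) % 2 = 0 := by omega
    simp only [pairSwap, h, h', ↓reduceDIte]
    omega

lemma pairSign_pairSwap (i : Fin (2 * n)) : pairSign (pairSwap i) = -pairSign i := by
  by_cases h : i.val % 2 = 0
  · have h' : (i.val + 1) % 2 ≠ 0 := by omega
    simp [pairSwap, pairSign, h, h']
  · have h' : (i.val - 1) % 2 = 0 := by omega
    simp [pairSwap, pairSign, h, h']

lemma pairSign_mul_self (i : Fin (2 * n)) : pairSign i * pairSign i = 1 := by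
  rw [pairSign]
  split_ifs <;> norm_num

lemma heisenbergField_apply (x : EuclideanSpace ℝ (Fin (2 * n))) (i : Fin (2 * n)) :
    heisenbergField n x i = pairSign i * x (pairSwap i) := by
  by_cases h : i.val % 2 = 0 <;> simp [heisenbergField, pairSwap, pairSign, h]

/-- `heisenbergField` as a linear map, the standard complex structure up to sign. -/
def heisenbergLinearMap (n : ℕ) :
    EuclideanSpace ℝ (Fin (2 * n)) →ₗ[ℝ] EuclideanSpace ℝ (Fin (2 * n)) where
  toFun := heisenbergField n
  map_add' x y := by
    ext i
    simp only [heisenbergField_apply, PiLp.add_apply, mul_add]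
  map_smul' c x := by
    ext i
    simp only [heisenbergField_apply, PiLp.smul_apply, smul_eq_mul, RingHom.id_apply, mul_left_comm]

lemma hasFDerivAt_heisenbergField (x : EuclideanSpace ℝ (Fin (2 * n))) :
    HasFDerivAt (heisenbergField n) (heisenbergLinearMap n).toContinuousLinearMap x :=
  (heisenbergLinearMap n).toContinuousLinearMap.hasFDerivAt

lemma contDiff_heisenbergField {k : WithTop ℕ∞} : ContDiff ℝ k (heisenbergField n) :=
  (heisenbergLinearMap n).toContinuousLinearMap.contDiff

lemma inner_heisenbergField (x y : EuclideanSpace ℝ (Fin (2 * n))) :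
    ⟪heisenbergField n x, y⟫ = -⟪x, heisenbergField n y⟫ := by
  simp only [PiLp.inner_apply, Real.inner_apply, heisenbergField_apply]
  rw [← Equiv.sum_comp pairSwap_involutive.toPerm, ← Finset.sum_neg_distrib]
  refine Finset.sum_congr rfl fun i _ => ?_
  rw [Function.Involutive.coe_toPerm, pairSwap_involutive, pairSign_pairSwap]
  ring

lemma heisenbergField_heisenbergField (x : EuclideanSpace ℝ (Fin (2 * n))) :
    heisenbergField n (heisenbergField n x) = -x := by
  ext i
  rw [heisenbergField_apply, heisenbergField_apply, pairSwap_involutive, pairSign_pairSwap,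
    ← mul_assoc, mul_neg, pairSign_mul_self, neg_one_mul, PiLp.neg_apply]

lemma heisenbergField_injective : Function.Injective (heisenbergField n) := by
  intro x y hxy
  simpa only [heisenbergField_heisenbergField, neg_inj] using congrArg (heisenbergField n) hxy

lemma exists_inner_fderiv_heisenbergField_ne (hn : 4 ≤ 2 * n)
    (x a : EuclideanSpace ℝ (Fin (2 * n))) :
    ∃ ξ ζ, ⟪a, ξ⟫ = 0 ∧ ⟪a, ζ⟫ = 0 ∧
      ⟪fderiv ℝ (heisenbergField n) x ξ, ζ⟫ ≠ ⟪fderiv ℝ (heisenbergField n) x ζ, ξ⟫ := by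
  rw [(hasFDerivAt_heisenbergField x).fderiv]
  exact exists_inner_map_ne_of_skew (J := heisenbergLinearMap n)
    (by rw [finrank_euclideanSpace_fin]; omega) inner_heisenbergField heisenbergField_injective a

end Heisenberg

section PlanarExample

lemma horizontalMeanCurvature_eq_zero_of_eventually_eq_smul {m : ℕ}
    {F : EuclideanSpace ℝ (Fin m) → EuclideanSpace ℝ (Fin m)} {u : EuclideanSpace ℝ (Fin m) → ℝ}
    {x e : EuclideanSpace ℝ (Fin m)}
    (h : ∀ᶠ y in 𝓝 x, ∃ k : ℝ, 0 < k ∧ gradient u y + F y = k • e) :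
    horizontalMeanCurvature F u x = 0 := by
  have hconst : (𝐧 ∘ fun y => gradient u y + F y) =ᶠ[𝓝 x] fun _ => 𝐧 e := by
    filter_upwards [h] with y ⟨k, hk, hy⟩
    rw [Function.comp_apply, hy, NormedSpace.normalize_smul_of_pos hk]
  rw [horizontalMeanCurvature_eq_traceCLM, hconst.fderiv_eq, fderiv_const_apply, map_zero]

/-- The wedge `{x¹ > 0, x¹ + x² > 0}` of the plane, with indices shifted to start at `0`. -/
def planarWedge : Set (EuclideanSpace ℝ (Fin (2 * 1))) := {x | 0 < x 0 ∧ 0 < x 0 + x 1}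

lemma isOpen_planarWedge : IsOpen planarWedge :=
  (isOpen_Ioi.preimage (EuclideanSpace.proj (𝕜 := ℝ) (0 : Fin (2 * 1))).continuous).inter
    (isOpen_Ioi.preimage
      (EuclideanSpace.proj (𝕜 := ℝ) (0 : Fin (2 * 1)) + EuclideanSpace.proj 1).continuous)

lemma convex_planarWedge : Convex ℝ planarWedge :=
  (convex_halfSpace_gt (EuclideanSpace.proj (𝕜 := ℝ) (0 : Fin (2 * 1))).isLinear 0).inter
    (convex_halfSpace_gt
      (EuclideanSpace.proj (𝕜 := ℝ) (0 : Fin (2 * 1)) + EuclideanSpace.proj 1).isLinear 0)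

lemma vec_one_mem_planarWedge {t : ℝ} (ht : 0 ≤ t) :
    (!₂[1, t] : EuclideanSpace ℝ (Fin (2 * 1))) ∈ planarWedge :=
  ⟨one_pos, add_pos_of_pos_of_nonneg one_pos ht⟩

lemma gradient_mul_add_mul_sq_add_heisenbergField (k : ℝ) (x : EuclideanSpace ℝ (Fin (2 * 1))) :
    gradient (fun x : EuclideanSpace ℝ (Fin (2 * 1)) => x 0 * x 1 + k * x 1 ^ 2) x
      + heisenbergField 1 x = (2 * (x 0 + k * x 1)) • EuclideanSpace.single 1 (1 : ℝ) := by
  have hcoord (i : Fin (2 * 1)) : HasFDerivAt (fun x : EuclideanSpace ℝ (Fin (2 * 1)) => x i)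
      (EuclideanSpace.proj i : EuclideanSpace ℝ (Fin (2 * 1)) →L[ℝ] ℝ) x :=
    (EuclideanSpace.proj i : EuclideanSpace ℝ (Fin (2 * 1)) →L[ℝ] ℝ).hasFDerivAt
  have hderiv : HasFDerivAt
      (fun x : EuclideanSpace ℝ (Fin (2 * 1)) => x 0 * x 1 + k * x 1 ^ 2) _ x :=
    ((hcoord 0).mul (hcoord 1)).add (((hcoord 1).pow 2).const_mul k)
  have hgrad (i : Fin (2 * 1)) :
      gradient (fun x : EuclideanSpace ℝ (Fin (2 * 1)) => x 0 * x 1 + k * x 1 ^ 2) x i =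
      fderiv ℝ (fun x : EuclideanSpace ℝ (Fin (2 * 1)) => x 0 * x 1 + k * x 1 ^ 2) x
        (EuclideanSpace.single i 1) := by
    rw [← inner_gradient_left, EuclideanSpace.inner_single_right, conj_trivial, one_mul]
  ext i
  rw [PiLp.add_apply, hgrad, hderiv.fderiv]
  rw [PiLp.smul_apply]
  fin_cases i
  · simp [heisenbergField]
  · suffices x 0 + k * (2 * x 1) + x 0 = 2 * (x 0 + k * x 1) by simpa [heisenbergField] using this
    ring

lemma isNonsingularDomain_planarWedge {k : ℝ} (hk : ∀ x ∈ planarWedge, 0 < x 0 + k * x 1) :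
    IsNonsingularDomain (heisenbergField 1) (fun x => x 0 * x 1 + k * x 1 ^ 2) planarWedge := by
  refine ⟨isOpen_planarWedge,
    ⟨⟨_, vec_one_mem_planarWedge le_rfl⟩, convex_planarWedge.isPreconnected⟩, fun x hx => ?_⟩
  rw [gradient_mul_add_mul_sq_add_heisenbergField]
  exact smul_ne_zero (mul_pos two_pos (hk x hx)).ne' (by simp)

lemma horizontalMeanCurvature_mul_add_mul_sq {k : ℝ}
    (hk : ∀ x ∈ planarWedge, 0 < x 0 + k * x 1) {x : EuclideanSpace ℝ (Fin (2 * 1))}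
    (hx : x ∈ planarWedge) :
    horizontalMeanCurvature (heisenbergField 1) (fun x => x 0 * x 1 + k * x 1 ^ 2) x = 0 := by
  refine horizontalMeanCurvature_eq_zero_of_eventually_eq_smul
    (e := EuclideanSpace.single 1 1) ?_
  filter_upwards [isOpen_planarWedge.mem_nhds hx] with y hy
  exact ⟨_, mul_pos two_pos (hk y hy), gradient_mul_add_mul_sq_add_heisenbergField k y⟩

end PlanarExample

/-- The first conjunct is the strong maximum principle for `m = 2n ≥ 4`. The second says that for
`m = 2` the functions `u = x¹x² + (x²)²` and `v = x¹x²` on `U = {x¹ > 0, x¹ + x² > 0}` satisfy all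
the hypotheses (indeed `H_F(u) = H_F(v) = 0`), touching exactly along `x² = 0`, but `u ≢ v`. -/
theorem corollaryI :
    (∀ (n : ℕ), 4 ≤ 2 * n →
      ∀ (U : Set (EuclideanSpace ℝ (Fin (2 * n)))) (u v : EuclideanSpace ℝ (Fin (2 * n)) → ℝ)
        (p₀ : EuclideanSpace ℝ (Fin (2 * n))),
        ContDiffOn ℝ 2 u U → ContDiffOn ℝ 2 v U →
        IsNonsingularDomain (heisenbergField n) u U →
        IsNonsingularDomain (heisenbergField n) v U →
        (∀ x ∈ U, horizontalMeanCurvature (heisenbergField n) u x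
          ≤ horizontalMeanCurvature (heisenbergField n) v x) →
        (∀ x ∈ U, v x ≤ u x) →
        p₀ ∈ U → u p₀ = v p₀ →
        ∀ x ∈ U, u x = v x) ∧
    (∀ (U : Set (EuclideanSpace ℝ (Fin (2 * 1)))) (u v : EuclideanSpace ℝ (Fin (2 * 1)) → ℝ),
      U = {x | 0 < x 0 ∧ 0 < x 0 + x 1} →
      u = (fun x => x 0 * x 1 + x 1 ^ 2) →
      v = (fun x => x 0 * x 1) →
        ContDiffOn ℝ 2 u U ∧ ContDiffOn ℝ 2 v U ∧
        IsNonsingularDomain (heisenbergField 1) u U ∧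
        IsNonsingularDomain (heisenbergField 1) v U ∧
        (∀ x ∈ U, horizontalMeanCurvature (heisenbergField 1) u x = 0 ∧
          horizontalMeanCurvature (heisenbergField 1) v x = 0) ∧
        (∀ x ∈ U, v x ≤ u x) ∧
        (∃ p₀ ∈ U, u p₀ = v p₀) ∧
        (∀ x ∈ U, u x = v x ↔ x 1 = 0) ∧
        ¬ ∀ x ∈ U, u x = v x) := by
  refine ⟨fun n hn U u v p₀ hu hv hUu _ hH hvu hp₀ h₀ => ?_, ?_⟩
  · exact corollaryI_general hu hv contDiff_heisenbergField.contDiffOn hUu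
      (fun x _ => exists_inner_fderiv_heisenbergField_ne hn x) (fun x hx _ => hH x hx) hvu hp₀ h₀
  rintro U u v hU rfl rfl
  obtain rfl : U = planarWedge := hU
  have hu : ∀ x ∈ planarWedge, 0 < x 0 + 1 * x 1 := fun x hx => by simpa using hx.2
  have hv : ∀ x ∈ planarWedge, 0 < x 0 + 0 * x 1 := fun x hx => by simpa using hx.1
  refine ⟨ContDiff.contDiffOn (by fun_prop), ContDiff.contDiffOn (by fun_prop),
    by simpa using isNonsingularDomain_planarWedge hu,
    by simpa using isNonsingularDomain_planarWedge hv,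
    fun x hx => ⟨by simpa using horizontalMeanCurvature_mul_add_mul_sq hu hx,
      by simpa using horizontalMeanCurvature_mul_add_mul_sq hv hx⟩,
    fun x _ => le_add_of_nonneg_right (sq_nonneg (x 1)),
    ⟨_, vec_one_mem_planarWedge le_rfl, by simp⟩, fun x _ => by simp, fun h => ?_⟩
  simpa using h _ (vec_one_mem_planarWedge zero_le_one)
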